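/- Let $\mathfrak g^c$ be a finite-dimensional complex semisimple Lie algebra with a Cartan subalgebra, root system $\Delta$, positive roots $\Delta^+$ determined by a simple system, and let $(\,,\,)$ be the form on the dual of the Cartan subalgebra induced by the Killing form. Let $s_0$ be the Weyl group element that maps the positive Weyl chamber into its negative. Let $\beta_1,\dots,\beta_s$ be the strongly orthogonal positive roots obtained by Dadok's construction: put $\Delta_1=\Delta$; as long as $\Delta_i\neq\emptyset$, let $\beta_i$ be the highest root (for the order given by $\Delta^+$) of an irreducible component of $\Delta_i$, and put $\Delta_{i+1}=\{\alpha\in\Delta_i:(\alpha,\beta_i)=0\}$; the construction stops with $\Delta_{s+1}=\emptyset$. For each $i$ let $X_{-\beta_i}\neq 0$ be a root vector for the root $-\beta_i$. Let $\pi_\lambda$ be the finite-dimensional irreducible representation of $\mathfrak g^c$ with highest weight $\lambda$, let $v_\lambda$ be a highest weight vector, and put $$n_i=\frac{(\lambda,\beta_i)-(s_0\lambda,\beta_i)}{(\beta_i,\beta_i)}\quad(i=1,\dots,s),\qquad k(\lambda)=\sum_{i=1}^s n_i .$$ Let $\mathcal U^{l}(\mathfrak g^c)$ be the $l$-th level of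 the natural filtration of the universal enveloping algebra, i.e. the span of all products of at most $l$ elements of $\mathfrak g^c$. Then the $n_i$ and $k(\lambda)$ are nonnegative integers, and the vector $$s_0v_\lambda=\pi_\lambda(X_{-\beta_1})^{n_1}\cdots\pi_\lambda(X_{-\beta_s})^{n_s}v_\lambda$$ lies in $\mathcal U^{k(\lambda)}(\mathfrak g^c)v_\lambda$, but not in $\mathcal U^{l}(\mathfrak g^c)v_\lambda$ for any $l<k(\lambda)$. -/

import Mathlib

namespace Dadok

noncomputable section

section RootCombinatorics

variable {ι M N : Type*} [AddCommGroup M] [Module ℂ M] [AddCommGroup N] [Module ℂ N]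

/-- The irreducible component of the root `i` in the set of roots `Φ`: all roots that can be joined
to `i` by a chain of roots of `Φ` in which consecutive roots are not orthogonal. -/
def component (P : RootPairing ι ℂ M N) (Φ : Set ι) (i : ι) : Set ι :=
  {j | Relation.ReflTransGen (fun a b => a ∈ Φ ∧ b ∈ Φ ∧ ¬ P.IsOrthogonal a b) i j}

/-- `i` is the highest root of the set of roots `Ψ`, in the partial order induced by the positive
roots of the base `b`: `j ≤ i` when `root i - root j` is a sum of positive roots. -/
def IsHighestRoot {P : RootPairing ι ℂ M N} (b : P.Base) (Ψ : Set ι) (i : ι) : Prop :=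
  i ∈ Ψ ∧ ∀ j ∈ Ψ, P.root i - P.root j ∈ AddSubmonoid.closure (P.root '' {k | b.IsPos k})

/-- `IsDadokSequence b Φ [β₁, …, βₛ]`: the list arises from the root subsystem `Φ` by repeating the
step "choose the highest root of an irreducible component, and pass to the subsystem of the roots
orthogonal to it" until no root is left. -/
inductive IsDadokSequence {P : RootPairing ι ℂ M N} (b : P.Base) : Set ι → List ι → Prop
  | nil : IsDadokSequence b ∅ []
  | cons {Φ : Set ι} {β : ι} {l : List ι} (mem : β ∈ Φ)
      (highest : IsHighestRoot b (component P Φ β) β)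
      (tail : IsDadokSequence b {α ∈ Φ | P.IsOrthogonal α β} l) :
      IsDadokSequence b Φ (β :: l)

end RootCombinatorics

section WeylChamber

variable {ι M N : Type*} [AddCommGroup M] [Module ℂ M] [AddCommGroup N] [Module ℂ N]

/-- The (open) positive Weyl chamber: the elements `x` of the weight space that have positive real
pairing with the coroots of all positive roots. -/
def positiveChamber {P : RootPairing ι ℂ M N} (b : P.Base) : Set M :=
  {x | ∀ i, b.IsPos i → ∃ r : ℝ, 0 < r ∧ P.toLinearMap x (P.coroot i) = (r : ℂ)}

/-- The Weyl group element `w` maps the positive Weyl chamber into its negative. -/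
def IsLongest {P : RootPairing ι ℂ M N} (b : P.Base) (w : P.weylGroup) : Prop :=
  ∀ x ∈ positiveChamber b, -(w • x) ∈ positiveChamber b

end WeylChamber

section Enveloping

variable {L : Type*} [LieRing L] [LieAlgebra ℂ L]

variable (L) in
/-- The `k`-th level of the natural filtration of the universal enveloping algebra: the span of the
products of at most `k` elements of `L`. -/
def envelopingFiltration (k : ℕ) : Submodule ℂ (UniversalEnvelopingAlgebra ℂ L) :=
  Submodule.span ℂ
    {u | ∃ l : List L, l.length ≤ k ∧ u = (l.map (UniversalEnvelopingAlgebra.ι ℂ)).prod}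

variable {V : Type*} [AddCommGroup V] [Module ℂ V] [LieRingModule L V] [LieModule ℂ L V]

variable (L) in
/-- The subset `U^k(L) v` of the `L`-module `V`. -/
def filtrationOrbit (k : ℕ) (v : V) : Set V :=
  {x | ∃ u ∈ envelopingFiltration L k,
    x = UniversalEnvelopingAlgebra.lift ℂ (LieModule.toEnd ℂ L V) u v}

end Enveloping

section Highest

open LieAlgebra LieAlgebra.IsKilling

variable {L : Type*} [LieRing L] [LieAlgebra ℂ L] [FiniteDimensional ℂ L] [IsKilling ℂ L]
  {H : LieSubalgebra ℂ L} [H.IsCartanSubalgebra]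

/-- The bilinear form on the dual of the Cartan subalgebra induced by the Killing form: the Killing
form of the elements of `H` that represent `φ` and `ψ`. -/
def killingDual (φ ψ : Module.Dual ℂ H) : ℂ :=
  killingForm ℂ L ((cartanEquivDual H).symm φ : H) ((cartanEquivDual H).symm ψ : H)

/-- The number `n = ((lam, β) - (w lam, β)) / (β, β)` attached to a root `β`. -/
def dadokCoeff (w : (rootSystem H).weylGroup) (lam : Module.Dual ℂ H) (β : H.root) : ℂ :=
  (killingDual lam ((rootSystem H).root β) - killingDual (w • lam) ((rootSystem H).root β)) /
    killingDual ((rootSystem H).root β) ((rootSystem H).root β)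

/-- The invariant `k(lam) = ∑ i, ((lam, β i) - (w lam, β i)) / (β i, β i)`. -/
def dadokInvariant {s : ℕ} (w : (rootSystem H).weylGroup) (β : Fin s → H.root)
    (lam : Module.Dual ℂ H) : ℂ :=
  ∑ i, dadokCoeff w lam (β i)

/-- `v` is a highest weight vector of weight `lam` for the positive roots of the base `b`. -/
structure IsHighestWeightVector {V : Type*} [AddCommGroup V] [Module ℂ V] [LieRingModule L V]
    [LieModule ℂ L V] (b : (rootSystem H).Base) (lam : Module.Dual ℂ H) (v : V) : Prop where
  ne_zero : v ≠ 0
  weight : ∀ h : H, ⁅(h : L), v⁆ = lam h • v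
  pos : ∀ α : H.root, b.IsPos α → ∀ x ∈ rootSpace H ((rootSystem H).root α), ⁅x, v⁆ = 0

end Highest

end

end Dadok

/-!
The integers `n i` are the values `lam (coroot (β i))`, because the longest element `w₀` is the
product of the reflections in `β 0, …, β (s - 1)`. Indeed let `α` be a positive root and `β i` the
first of these roots that is not orthogonal to it. As `β i` is highest in its component, `α` pairs
positively with it; the product of the reflections sends `α` to a root of the same subsystem that
pairs negatively with `β i`, hence to a negative root
(`IsDadokSequence.not_isPos_reflectionProd`). Two Weyl group elements that make all positive roots
negative agree, by the exchange condition (`IsLongest.smul_eq_reflectionProd`). The values are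
natural numbers by the representation theory of `sl₂`.

The vector `z = X₀ ^ n₀ ⋯ v` visibly has filtration level at most `k = ∑ n i`. That it has no
smaller level is shown by splitting off the first root `β` of the sequence. Let `h` be its coroot
and let `e`, `f = X₀` be root vectors for `β`, `-β`, completing `h` to an `sl₂`-triple. The eigenvalues of
`ad h` grade the Lie algebra in degrees `-2, …, 2`, with `e` and `f` spanning the spaces of degree
`2` and `-2`. Let `P w` be the span of the monomials of length at most `w`, in elements of degree at
most `0`, applied to `v`. Commuting elements to the right, where those of positive degree kill `v`,
shows that degree `1` elements preserve each `P w`, while `e` maps `P w` to `P (w - 1)`: it absorbs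
two factors of degree `-1` into one of degree `0`, or one factor of degree `-2` into a multiple of
`h`, which acts on monomials by scalars (`IsContactGrading.lie_two_prod`). In particular every
vector of level `w` lies in `P w`.

Now `z = f ^ n z'`, where `z'` is the corresponding vector for the remaining roots; `e` kills `z'`,
which has the same `h`-weight `n` as `v`, so `e ^ n z` is a nonzero multiple of `z'`. If `z` has
level `w`, then `z'` lies in `P (w - n)`, and in fact in the span of the monomials in elements of
degree `0`, because factors of negative degree lower the `h`-weight. The elements of degree `0` are
those of the subalgebra attached to the roots orthogonal to `β`, so induction applies
(`sum_le_of_prod_mem_monomialSpan`). In the end `v ≠ 0` has level at least `0`.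
-/

namespace Dadok

/-! ### The longest element of the Weyl group -/

section WeylGroup

variable {ι M N : Type*} [AddCommGroup M] [Module ℂ M] [AddCommGroup N] [Module ℂ N]
  {P : RootPairing ι ℂ M N}

lemma root_reflectionPerm_self (i : ι) :
    P.root (P.reflectionPerm i i) = -P.root i := by
  rw [P.root_reflectionPerm, P.reflection_apply_self]

variable (P) in
/-- The product of the reflections in the roots of a list. -/
noncomputable def reflectionProd (l : List ι) : M ≃ₗ[ℂ] M := (l.map P.reflection).prod

@[simp] lemma reflectionProd_nil : reflectionProd P [] = 1 := rfl

lemma reflectionProd_cons (i : ι) (l : List ι) :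
    reflectionProd P (i :: l) = P.reflection i * reflectionProd P l := by
  simp [reflectionProd]

lemma reflectionProd_append (l l' : List ι) :
    reflectionProd P (l ++ l') = reflectionProd P l * reflectionProd P l' := by
  simp [reflectionProd]

lemma reflection_mul_self (i : ι) : P.reflection i * P.reflection i = 1 := by
  ext x; simp

lemma exists_root_eq_reflectionProd (l : List ι) (i : ι) :
    ∃ k, P.root k = reflectionProd P l (P.root i) := by
  induction l with
  | nil => exact ⟨i, by simp⟩
  | cons j l ih =>
    obtain ⟨k, hk⟩ := ih
    exact ⟨P.reflectionPerm j k, by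
      rw [P.root_reflectionPerm, hk, reflectionProd_cons, LinearEquiv.mul_apply]⟩

/-- If a product `g` of reflections sends the root `j` to the root `i`, then it conjugates the
reflection in `j` to the reflection in `i`. -/
lemma reflection_mul_reflectionProd {l : List ι} {i j : ι}
    (h : P.root i = reflectionProd P l (P.root j)) :
    P.reflection i * reflectionProd P l = reflectionProd P l * P.reflection j := by
  induction l generalizing i with
  | nil =>
    obtain rfl : i = j := P.root.injective (by simpa using h)
    simp
  | cons c l ih =>
    have h' : P.root (P.reflectionPerm c i) = reflectionProd P l (P.root j) := by
      rw [P.root_reflectionPerm, h, reflectionProd_cons, LinearEquiv.mul_apply, P.reflection_same]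
    have hc : P.reflection c * P.reflection (P.reflectionPerm c i) =
        P.reflection i * P.reflection c := by
      ext x
      simp [RootPairing.reflection_reflectionPerm]
    rw [reflectionProd_cons, mul_assoc, ← ih h', ← mul_assoc, ← mul_assoc, hc]

lemma exists_weylGroup_smul_eq_reflectionProd (l : List ι) :
    ∃ w : P.weylGroup, ∀ x : M, w • x = reflectionProd P l x := by
  induction l with
  | nil => exact ⟨1, by simp⟩
  | cons i l ih =>
    obtain ⟨w, hw⟩ := ih
    refine ⟨RootPairing.weylGroup.ofIdx P i * w, fun x ↦ ?_⟩
    rw [mul_smul, hw, reflectionProd_cons]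
    rfl

lemma toLinearMap_smul_coroot (w : P.weylGroup) (x : M) (i : ι) :
    P.toLinearMap (w • x) (P.coroot (P.weylGroupToPerm w i)) = P.toLinearMap x (P.coroot i) := by
  obtain ⟨g, hg⟩ := w
  have key : ∀ (x : M) (i : ι), P.toLinearMap (g • x) (P.coroot (g • i)) =
      P.toLinearMap x (P.coroot i) := by
    induction hg using RootPairing.weylGroup.induction with
    | mem j =>
      intro x i
      have : RootPairing.Equiv.reflection P j • i = P.reflectionPerm j i := rfl
      rw [this, RootPairing.Equiv.reflection_smul, RootPairing.coroot_reflectionPerm]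
      simp [RootPairing.reflection_apply, RootPairing.coreflection_apply]
      ring
    | one => simp
    | mul g₁ g₂ _ _ h₁ h₂ => intro x i; rw [mul_smul, mul_smul, h₁, h₂]
  exact key x i

variable (b : P.Base)

variable [Finite ι] [P.IsCrystallographic] [P.IsReduced]

lemma isPos_reflectionPerm_iff {i j : ι} (hj : j ∈ b.support) (hij : i ≠ j)
    (hij' : i ≠ P.reflectionPerm j j) :
    b.IsPos (P.reflectionPerm j i) ↔ b.IsPos i := by
  refine ⟨fun h ↦ ?_, fun h ↦ h.reflectionPerm hj hij⟩
  have := h.reflectionPerm hj (fun h' ↦ hij' ?_)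
  · simpa using this
  · exact (P.reflectionPerm j).injective (by simpa using h')

/-- The exchange condition: if a word in the simple reflections makes the simple root `j` negative,
then multiplying it by the reflection in `j` amounts to deleting a letter. -/
lemma exists_reflectionProd_mul_eq {l : List ι} (hl : ∀ i ∈ l, i ∈ b.support) {j k : ι}
    (hj : j ∈ b.support) (hk : P.root k = reflectionProd P l (P.root j)) (hk' : ¬ b.IsPos k) :
    ∃ l' : List ι, (∀ i ∈ l', i ∈ b.support) ∧ l'.length < l.length ∧
      reflectionProd P l * P.reflection j = reflectionProd P l' := by
  induction l generalizing k with
  | nil =>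
    obtain rfl : k = j := P.root.injective (by simpa using hk)
    exact absurd (RootPairing.Base.isPos_of_mem_support hj) hk'
  | cons i l ih =>
    have hi : i ∈ b.support := hl i (by simp)
    have hl' : ∀ i ∈ l, i ∈ b.support := fun c hc ↦ hl c (by simp [hc])
    have h' : P.root (P.reflectionPerm i k) = reflectionProd P l (P.root j) := by
      rw [P.root_reflectionPerm, hk, reflectionProd_cons, LinearEquiv.mul_apply, P.reflection_same]
    by_cases hpos : b.IsPos (P.reflectionPerm i k)
    · -- The simple root `i` is the only positive root that its reflection makes negative.
      have hki : P.reflectionPerm i k = i := by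
        by_contra hne
        exact hk' (by simpa using hpos.reflectionPerm hi hne)
      rw [hki] at h'
      refine ⟨l, hl', by simp, ?_⟩
      rw [reflectionProd_cons, reflection_mul_reflectionProd h', mul_assoc, reflection_mul_self,
        mul_one]
    · obtain ⟨l', h₁, h₂, h₃⟩ := ih hl' h' hpos
      refine ⟨i :: l', ?_, by simpa using h₂, ?_⟩
      · simpa [hi] using h₁
      · rw [reflectionProd_cons, mul_assoc, h₃, reflectionProd_cons]

/-- A product of simple reflections that preserves the positive roots is the identity. -/
lemma reflectionProd_eq_one (n : ℕ) {l : List ι} (hn : l.length = n)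
    (hl : ∀ i ∈ l, i ∈ b.support)
    (hpos : ∀ i k, b.IsPos i → P.root k = reflectionProd P l (P.root i) → b.IsPos k) :
    reflectionProd P l = 1 := by
  induction n using Nat.strong_induction_on generalizing l with
  | h n ih =>
    rcases l.eq_nil_or_concat' with rfl | ⟨l', j, rfl⟩
    · simp
    have hj : j ∈ b.support := hl j (by simp)
    obtain ⟨k, hk⟩ := exists_root_eq_reflectionProd (P := P) l' j
    have hs : reflectionProd P (l' ++ [j]) = reflectionProd P l' * P.reflection j := by
      rw [reflectionProd_append, reflectionProd_cons, reflectionProd_nil, mul_one]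
    have hk' : ¬ b.IsPos k := by
      rw [← RootPairing.Base.IsPos.neg_iff_not b k]
      refine hpos j _ (RootPairing.Base.isPos_of_mem_support hj) ?_
      rw [hs, LinearEquiv.mul_apply, P.reflection_apply_self, map_neg, ← hk]
      exact root_reflectionPerm_self k
    obtain ⟨l'', h₁, h₂, h₃⟩ := exists_reflectionProd_mul_eq b
      (fun i hi ↦ hl i (by simp [hi])) hj hk hk'
    rw [hs, h₃] at hpos ⊢
    exact ih l''.length (by rw [← hn]; simp; omega) rfl h₁ hpos

/-- The Weyl group is generated by the simple reflections. -/
lemma exists_smul_eq_reflectionProd (w : P.weylGroup) :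
    ∃ l : List ι, (∀ i ∈ l, i ∈ b.support) ∧ ∀ x : M, w • x = reflectionProd P l x := by
  have key (i : ι) : ∃ l : List ι, (∀ j ∈ l, j ∈ b.support) ∧
      P.reflection i = reflectionProd P l := by
    induction i using b.induction_reflect with
    | h₀ i hi =>
      have : P.reflection (P.reflectionPerm i i) = P.reflection i := by
        ext x; simp [RootPairing.reflection_reflectionPerm]
      rwa [this]
    | h₁ i hi => exact ⟨[i], by simpa using hi, by simp [reflectionProd_cons]⟩
    | h₂ i j hi hj =>
      obtain ⟨l, hl, h⟩ := hi
      refine ⟨j :: (l ++ [j]), ?_, ?_⟩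
      · intro c hc
        simp only [List.mem_cons, List.mem_append, List.not_mem_nil, or_false] at hc
        rcases hc with rfl | hc | rfl
        exacts [hj, hl _ hc, hj]
      · rw [reflectionProd_cons, reflectionProd_append, reflectionProd_cons, reflectionProd_nil,
          mul_one, ← h]
        ext x; simp [RootPairing.reflection_reflectionPerm]
  obtain ⟨g, hg⟩ := w
  have : ∃ l : List ι, (∀ i ∈ l, i ∈ b.support) ∧ ∀ x : M, g • x = reflectionProd P l x := by
    induction hg using RootPairing.weylGroup.induction with
    | mem i =>
      obtain ⟨l, hl, h⟩ := key i
      exact ⟨l, hl, fun x ↦ by rw [RootPairing.Equiv.reflection_smul, h]⟩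
    | one => exact ⟨[], by simp, by simp⟩
    | mul g₁ g₂ _ _ h₁ h₂ =>
      obtain ⟨l₁, hl₁, h₁⟩ := h₁
      obtain ⟨l₂, hl₂, h₂⟩ := h₂
      refine ⟨l₁ ++ l₂, ?_, fun x ↦ ?_⟩
      · intro i hi
        rcases List.mem_append.mp hi with hi | hi
        exacts [hl₁ i hi, hl₂ i hi]
      · rw [mul_smul, h₁, h₂, reflectionProd_append, LinearEquiv.mul_apply]
  exact this

/-- A root is positive if and only if its coroot is. -/
lemma isPos_flip_iff (i : ι) : b.flip.IsPos i ↔ b.IsPos i := by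
  have hneg (i : ι) : b.IsPos (P.reflectionPerm i i) ↔ ¬ b.IsPos i :=
    RootPairing.Base.IsPos.neg_iff_not b i
  have hneg' (i : ι) : b.flip.IsPos (P.reflectionPerm i i) ↔ ¬ b.flip.IsPos i :=
    RootPairing.Base.IsPos.neg_iff_not b.flip i
  induction i using b.induction_reflect with
  | h₀ i hi =>
    replace hi : b.flip.IsPos i ↔ b.IsPos i := hi
    rw [hneg, hneg', hi]
  | h₁ i hi =>
    exact iff_of_true (RootPairing.Base.isPos_of_mem_support (b := b.flip) hi)
      (RootPairing.Base.isPos_of_mem_support hi)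
  | h₂ i j hi hj =>
    replace hi : b.flip.IsPos i ↔ b.IsPos i := hi
    by_cases hij : i = j
    · subst hij; rw [hneg, hneg', hi]
    by_cases hij' : i = P.reflectionPerm j j
    · subst hij'; rw [hneg, hneg'] at hi; simpa [not_iff_not] using hi
    rw [isPos_reflectionPerm_iff b hj hij hij', ← hi]
    exact isPos_reflectionPerm_iff b.flip hj hij hij'

variable [P.IsRootSystem]

omit [Finite ι] [P.IsCrystallographic] [P.IsReduced] in
/-- The height of a root extends to a linear functional on the weight space. -/
lemma exists_linearMap_root_eq_height :
    ∃ f : M →ₗ[ℂ] ℂ, ∀ i, f (P.root i) = (b.height i : ℂ) := by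
  refine ⟨b.toWeightBasis.constr ℂ (fun _ ↦ (1 : ℂ)), fun i ↦ ?_⟩
  obtain ⟨f, -, -, hf⟩ := b.exists_root_eq_sum_int i
  rw [RootPairing.Base.height_eq_sum hf, hf, map_sum, Int.cast_sum]
  refine Finset.sum_congr rfl fun j hj ↦ ?_
  have := b.toWeightBasis.constr_basis ℂ (fun _ ↦ (1 : ℂ)) ⟨j, hj⟩
  rw [b.toWeightBasis_apply] at this
  rw [map_zsmul, this, zsmul_eq_mul, mul_one]

/-- The weight whose pairing with each coroot is the height of that coroot lies in the positive
chamber. -/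
lemma positiveChamber_nonempty : (positiveChamber b).Nonempty := by
  obtain ⟨f, hf⟩ := exists_linearMap_root_eq_height b.flip
  refine ⟨P.toPerfPair.symm f, fun i hi ↦ ⟨b.flip.height i, ?_, ?_⟩⟩
  · exact_mod_cast (isPos_flip_iff b i).mpr hi
  · have : P.toLinearMap (P.toPerfPair.symm f) = f := P.toPerfPair.apply_symm_apply f
    rw [this]
    simpa using hf i

lemma IsLongest.not_isPos {b : P.Base} {w : P.weylGroup} (hw : IsLongest b w) {i : ι}
    (hi : b.IsPos i) : ¬ b.IsPos (P.weylGroupToPerm w⁻¹ i) := by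
  intro hi'
  obtain ⟨x, hx⟩ := positiveChamber_nonempty b
  obtain ⟨r, hr, hxr⟩ := hx _ hi'
  obtain ⟨r', hr', hxr'⟩ := hw x hx i hi
  have h := toLinearMap_smul_coroot w x (P.weylGroupToPerm w⁻¹ i)
  have h' : P.weylGroupToPerm w (P.weylGroupToPerm w⁻¹ i) = i := by
    rw [← Equiv.Perm.mul_apply, ← map_mul]; simp
  rw [h', hxr] at h
  rw [map_neg, LinearMap.neg_apply, h] at hxr'
  have : -r = r' := by exact_mod_cast hxr'
  linarith

/-- A product of reflections that makes all positive roots negative is the longest element. -/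
lemma IsLongest.smul_eq_reflectionProd {b : P.Base} {w : P.weylGroup} (hw : IsLongest b w)
    {l : List ι}
    (hl : ∀ i k, b.IsPos i → P.root k = reflectionProd P l (P.root i) → ¬ b.IsPos k) (x : M) :
    w • x = reflectionProd P l x := by
  obtain ⟨w', hw'⟩ := exists_weylGroup_smul_eq_reflectionProd (P := P) l
  obtain ⟨l', hl', h⟩ := exists_smul_eq_reflectionProd b (w' * w⁻¹)
  have h1 : reflectionProd P l' = 1 := by
    refine reflectionProd_eq_one b _ rfl hl' fun i k hi hk ↦ ?_
    have hneg := hw.not_isPos hi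
    rw [← h, mul_smul, RootPairing.weylGroup_apply_root, hw'] at hk
    rw [← RootPairing.Base.IsPos.neg_iff_not b] at hneg
    have := hl _ (P.reflectionPerm k k) hneg (by
      rw [root_reflectionPerm_self, hk]
      exact (map_neg (reflectionProd P l) _).symm.trans
        (congrArg _ (root_reflectionPerm_self _).symm))
    by_contra hk'
    exact this ((RootPairing.Base.IsPos.neg_iff_not b k).mpr hk')
  have := h (w • x)
  rw [h1, mul_smul, inv_smul_smul, hw'] at this
  simpa using this.symm

end WeylGroup

/-! ### Highest roots and Dadok sequences -/

section HighestRoot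

variable {ι M N : Type*} [AddCommGroup M] [Module ℂ M] [AddCommGroup N] [Module ℂ N]
  {P : RootPairing ι ℂ M N}

variable (P) in
/-- The closed subsystem of the roots that lie in a subspace `W` of the weight space. All sets of
roots met in Dadok's construction are of this form. -/
def rootsIn (W : Submodule ℂ M) : Set ι := {i | P.root i ∈ W}

@[simp] lemma mem_rootsIn {W : Submodule ℂ M} {i : ι} : i ∈ rootsIn P W ↔ P.root i ∈ W := Iff.rfl

lemma IsDadokSequence.subset {b : P.Base} {Φ : Set ι} {l : List ι} (h : IsDadokSequence b Φ l) :
    ∀ i ∈ l, i ∈ Φ := by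
  induction h with
  | nil => simp
  | cons mem _ _ ih =>
    intro i hi
    rcases List.mem_cons.mp hi with rfl | hi
    exacts [mem, (ih i hi).1]

lemma IsDadokSequence.cons_rootsIn {b : P.Base} {W : Submodule ℂ M} {β : ι} {l : List ι}
    (h : IsDadokSequence b (rootsIn P W) (β :: l)) :
    P.root β ∈ W ∧ IsHighestRoot b (component P (rootsIn P W) β) β ∧
      IsDadokSequence b (rootsIn P (W ⊓ LinearMap.ker (P.coroot' β))) l := by
  generalize hΦ : rootsIn P W = Φ at h
  cases h with
  | cons mem highest tail =>
    subst hΦ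
    refine ⟨mem, highest, ?_⟩
    convert tail using 1
    ext i
    simp [RootPairing.isOrthogonal_iff_pairing_eq_zero]

lemma toLinearMap_reflection_coroot (i j : ι) (x : M) :
    P.toLinearMap (P.reflection i x) (P.coroot j) =
      P.toLinearMap x (P.coroot j) - P.toLinearMap x (P.coroot i) * P.pairing i j := by
  simp [RootPairing.reflection_apply]

lemma toLinearMap_reflectionProd_coroot_of_orthogonal {l : List ι} {j : ι}
    (h : ∀ i ∈ l, P.pairing i j = 0) (x : M) :
    P.toLinearMap (reflectionProd P l x) (P.coroot j) = P.toLinearMap x (P.coroot j) := by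
  induction l with
  | nil => simp
  | cons i l ih =>
    rw [reflectionProd_cons, LinearEquiv.mul_apply, toLinearMap_reflection_coroot,
      h i (by simp), ih fun k hk ↦ h k (by simp [hk])]
    ring

lemma IsDadokSequence.toLinearMap_reflectionProd_coroot {b : P.Base} {Φ : Set ι} {l : List ι}
    (h : IsDadokSequence b Φ l) (x : M) {i : ι} (hi : i ∈ l) :
    P.toLinearMap (reflectionProd P l x) (P.coroot i) = -P.toLinearMap x (P.coroot i) := by
  induction h generalizing i with
  | nil => simp at hi
  | @cons Φ β l mem highest tail ih =>
    have horth (k : ι) (hk : k ∈ l) : P.IsOrthogonal k β := (tail.subset k hk).2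
    have hβ := toLinearMap_reflectionProd_coroot_of_orthogonal (fun k hk ↦ (horth k hk).1) x
    rw [reflectionProd_cons, LinearEquiv.mul_apply, toLinearMap_reflection_coroot, hβ]
    rcases List.mem_cons.mp hi with rfl | hi
    · rw [P.pairing_same, hβ]; ring
    · rw [ih hi, (horth i hi).2]; ring

lemma reflectionProd_mem {W : Submodule ℂ M} {l : List ι} (h : ∀ i ∈ l, P.root i ∈ W) {x : M}
    (hx : x ∈ W) : reflectionProd P l x ∈ W := by
  induction l with
  | nil => simpa
  | cons i l ih =>
    rw [reflectionProd_cons, LinearEquiv.mul_apply, P.reflection_apply]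
    exact W.sub_mem (ih fun k hk ↦ h k (by simp [hk])) (W.smul_mem _ (h i (by simp)))

variable {b : P.Base}

/-- The height separates the cone spanned by the positive roots from zero. -/
lemma exists_nat_of_mem_closure {f : M →ₗ[ℂ] ℂ} (hf : ∀ i, f (P.root i) = (b.height i : ℂ))
    {x : M} (hx : x ∈ AddSubmonoid.closure (P.root '' {k | b.IsPos k})) :
    ∃ n : ℕ, f x = n ∧ (n = 0 → x = 0) := by
  induction hx using AddSubmonoid.closure_induction with
  | mem x hx =>
    obtain ⟨i, hi, rfl⟩ := hx
    have hi' : 0 < b.height i := hi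
    refine ⟨(b.height i).toNat, ?_, fun h ↦ by omega⟩
    rw [hf, ← Int.cast_natCast, Int.toNat_of_nonneg hi'.le]
  | zero => exact ⟨0, by simp⟩
  | add x y _ _ hx hy =>
    obtain ⟨n, hn, hn'⟩ := hx
    obtain ⟨m, hm, hm'⟩ := hy
    refine ⟨n + m, by simp [hn, hm], fun h ↦ ?_⟩
    rw [hn' (by omega), hm' (by omega), add_zero]

variable {W : Submodule ℂ M} {β : ι}

lemma IsHighestRoot.isPos [P.IsRootSystem]
    (hβ : IsHighestRoot b (component P (rootsIn P W) β) β)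
    (hβW : P.root β ∈ W) : b.IsPos β := by
  obtain ⟨f, hf⟩ := exists_linearMap_root_eq_height b
  have hneg : P.reflectionPerm β β ∈ rootsIn P W := by
    rw [mem_rootsIn, root_reflectionPerm_self]
    exact W.neg_mem hβW
  have := hβ.2 _ (Relation.ReflTransGen.single ⟨hβW, hneg, fun hor ↦ by
    simpa using hor.1⟩)
  obtain ⟨n, hn, -⟩ := exists_nat_of_mem_closure hf this
  rw [root_reflectionPerm_self, sub_neg_eq_add, map_add, hf] at hn
  have : b.height β + b.height β = n := by exact_mod_cast hn
  rw [RootPairing.Base.isPos_iff']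
  omega

lemma IsDadokSequence.isPos [P.IsRootSystem] {l : List ι}
    (h : IsDadokSequence b (rootsIn P W) l) : ∀ i ∈ l, b.IsPos i := by
  induction l generalizing W with
  | nil => simp
  | cons β l ih =>
    obtain ⟨hβW, hβ, htail⟩ := h.cons_rootsIn
    intro i hi
    rcases List.mem_cons.mp hi with rfl | hi
    exacts [hβ.isPos hβW, ih htail i hi]

variable [P.IsCrystallographic]

/-- If the root `α` pairs positively with the highest root `β` of its component, then so does the
negative of its reflection in `β`, which is therefore a root below `β`. -/
lemma IsHighestRoot.sub_mem_closure (hβ : IsHighestRoot b (component P (rootsIn P W) β) β)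
    (hβW : P.root β ∈ W) {α : ι} (hα : P.root α ∈ W) (h : 0 < P.pairingIn ℤ α β) :
    P.root α - (P.pairingIn ℤ α β - 1) • P.root β ∈
      AddSubmonoid.closure (P.root '' {k | b.IsPos k}) := by
  set γ := P.reflectionPerm β (P.reflectionPerm α α) with hγ
  have hroot : P.root γ = P.pairingIn ℤ α β • P.root β - P.root α := by
    rw [hγ, P.root_reflectionPerm, root_reflectionPerm_self, map_neg,
      P.reflection_apply_root' ℤ, neg_sub]
  have hpair : P.pairing γ β ≠ 0 := by
    rw [← P.root_coroot_eq_pairing, hroot]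
    have : ((P.pairingIn ℤ α β : ℤ) : ℂ) = P.pairing α β := P.algebraMap_pairingIn ℤ α β
    simp only [map_sub, map_zsmul, LinearMap.sub_apply, LinearMap.smul_apply,
      P.root_coroot_eq_pairing, P.pairing_same, ← this, zsmul_eq_mul]
    have h' : ((P.pairingIn ℤ α β : ℤ) : ℂ) ≠ 0 := by exact_mod_cast h.ne'
    intro h0
    apply h'
    linear_combination h0
  have hγW : γ ∈ rootsIn P W := by
    rw [mem_rootsIn, hroot]
    exact W.sub_mem (W.smul_of_tower_mem _ hβW) hα
  have := hβ.2 γ (Relation.ReflTransGen.single ⟨hβW, hγW, fun hor ↦ hpair hor.2⟩)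
  rw [hroot] at this
  convert this using 1
  module

variable [P.IsRootSystem]

lemma IsHighestRoot.isPos_of_pairing_pos (hβ : IsHighestRoot b (component P (rootsIn P W) β) β)
    (hβW : P.root β ∈ W) {α : ι} (hα : P.root α ∈ W) (h : 0 < P.pairingIn ℤ α β) :
    b.IsPos α := by
  obtain ⟨f, hf⟩ := exists_linearMap_root_eq_height b
  obtain ⟨n, hn, -⟩ := exists_nat_of_mem_closure hf (hβ.sub_mem_closure hβW hα h)
  rw [map_sub, map_zsmul, hf, hf, zsmul_eq_mul] at hn
  have hn : b.height α - (P.pairingIn ℤ α β - 1) * b.height β = n := by exact_mod_cast hn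
  have h2 : 0 < b.height β := hβ.isPos hβW
  rw [RootPairing.Base.isPos_iff']
  nlinarith

lemma IsHighestRoot.not_isPos_of_pairing_neg
    (hβ : IsHighestRoot b (component P (rootsIn P W) β) β)
    (hβW : P.root β ∈ W) {α : ι} (hα : P.root α ∈ W) (h : P.pairingIn ℤ α β < 0) :
    ¬ b.IsPos α := by
  rw [← RootPairing.Base.IsPos.neg_iff_not b α]
  refine hβ.isPos_of_pairing_pos hβW (α := P.reflectionPerm α α) ?_ ?_
  · rw [root_reflectionPerm_self]
    exact W.neg_mem hα
  · simpa using h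

/-- A highest root is long: it is the only root of the subsystem with pairing at least two. -/
lemma IsHighestRoot.eq_of_two_le_pairing (hβ : IsHighestRoot b (component P (rootsIn P W) β) β)
    (hβW : P.root β ∈ W) {α : ι} (hα : P.root α ∈ W) (h : 2 ≤ P.pairingIn ℤ α β) :
    α = β := by
  obtain ⟨f, hf⟩ := exists_linearMap_root_eq_height b
  obtain ⟨n, hn, -⟩ := exists_nat_of_mem_closure hf (hβ.sub_mem_closure hβW hα (by omega))
  rw [map_sub, map_zsmul, hf, hf, zsmul_eq_mul] at hn
  have hn : b.height α - (P.pairingIn ℤ α β - 1) * b.height β = n := by exact_mod_cast hn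
  have hcomp : α ∈ component P (rootsIn P W) β :=
    Relation.ReflTransGen.single ⟨hβW, hα, fun hor ↦ by
      have := hor.2
      rw [← P.algebraMap_pairingIn ℤ α β, FaithfulSMul.algebraMap_eq_zero_iff] at this
      omega⟩
  obtain ⟨m, hm, hm'⟩ := exists_nat_of_mem_closure hf (hβ.2 α hcomp)
  rw [map_sub, hf, hf] at hm
  have hm : b.height β - b.height α = m := by exact_mod_cast hm
  have h2 : 0 < b.height β := hβ.isPos hβW
  have hm0 : m = 0 := by
    have : (m : ℤ) ≤ 0 := by nlinarith
    omega
  exact (P.root.injective (sub_eq_zero.mp (hm' hm0))).symm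

/-- The product of the reflections in the roots of a Dadok sequence makes every positive root of
the subsystem negative. If `β` is the first root of the sequence that is not orthogonal to a
positive root `α`, then `α` has positive pairing with `β`, its image has negative pairing with `β`,
and these signs decide positivity. -/
lemma IsDadokSequence.not_isPos_reflectionProd {l : List ι}
    (hl : IsDadokSequence b (rootsIn P W) l) {i k : ι} (hi : P.root i ∈ W) (hpos : b.IsPos i)
    (hk : P.root k = reflectionProd P l (P.root i)) : ¬ b.IsPos k := by
  induction l generalizing W i k with
  | nil =>
    have : i ∈ rootsIn P W := hi
    generalize rootsIn P W = Φ at this hl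
    cases hl
    exact this.elim
  | cons β l ih =>
    obtain ⟨hβW, hβ, htail⟩ := hl.cons_rootsIn
    have hkW : P.root k ∈ W := hk ▸ reflectionProd_mem hl.subset hi
    have hpair : P.pairing k β = -P.pairing i β := by
      rw [← P.root_coroot_eq_pairing, hk,
        hl.toLinearMap_reflectionProd_coroot _ (by simp), P.root_coroot_eq_pairing]
    have hpair' : P.pairingIn ℤ k β = -P.pairingIn ℤ i β := by
      rw [← P.algebraMap_pairingIn ℤ k β, ← P.algebraMap_pairingIn ℤ i β] at hpair
      exact_mod_cast hpair
    rcases lt_trichotomy (P.pairingIn ℤ i β) 0 with h | h | h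
    · exact absurd hpos (hβ.not_isPos_of_pairing_neg hβW hi h)
    · have h0 : P.pairing i β = 0 := by rw [← P.algebraMap_pairingIn ℤ i β, h]; simp
      refine ih htail (i := i) ⟨hi, by simpa using h0⟩ hpos ?_
      have := toLinearMap_reflectionProd_coroot_of_orthogonal (P := P) (l := l) (j := β)
        (fun c hc ↦ by simpa using (htail.subset c hc).2) (P.root i)
      rw [hk, reflectionProd_cons, LinearEquiv.mul_apply, P.reflection_apply]
      rw [P.root_coroot_eq_pairing, h0] at this
      have h' : P.coroot' β (reflectionProd P l (P.root i)) = 0 := this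
      rw [h', zero_smul, sub_zero]
    · exact hβ.not_isPos_of_pairing_neg hβW hkW (by omega)

end HighestRoot

/-! ### Filtration levels in a graded Lie algebra -/

section Grading

variable {L : Type*} [LieRing L] [LieAlgebra ℂ L]
  {V : Type*} [AddCommGroup V] [Module ℂ V] [LieRingModule L V] [LieModule ℂ L V]

/-- The span of the vectors `x₁ ⋯ xᵣ v` with `xᵢ ∈ S` and `r ≤ w`. The bound `w` is an integer, and
the span is zero when it is negative. -/
def monomialSpan (S : Set L) (v : V) (w : ℤ) : Submodule ℂ V :=
  Submodule.span ℂ {z | ∃ l : List L, (∀ x ∈ l, x ∈ S) ∧ (l.length : ℤ) ≤ w ∧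
    z = (l.map (LieModule.toEnd ℂ L V)).prod v}

variable {S : Set L} {v : V}

lemma prod_mem_monomialSpan {l : List L} (hl : ∀ x ∈ l, x ∈ S) {w : ℤ} (hw : (l.length : ℤ) ≤ w) :
    (l.map (LieModule.toEnd ℂ L V)).prod v ∈ monomialSpan S v w :=
  Submodule.subset_span ⟨l, hl, hw, rfl⟩

lemma monomialSpan_mono {S' : Set L} (hS : S ⊆ S') {w w' : ℤ} (hw : w ≤ w') :
    monomialSpan S v w ≤ monomialSpan S' v w' :=
  Submodule.span_mono fun _ ⟨l, hl, hlw, hz⟩ ↦ ⟨l, fun x hx ↦ hS (hl x hx), hlw.trans hw, hz⟩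

lemma monomialSpan_eq_bot {w : ℤ} (hw : w < 0) : monomialSpan S v w = ⊥ := by
  rw [monomialSpan, Submodule.span_eq_bot]
  rintro _ ⟨l, -, hl, -⟩
  omega

/-- To bound the degree by which `x` raises the filtration, it suffices to look at monomials. -/
lemma lie_mem_monomialSpan_of_forall {x : L} {d : ℤ}
    (h : ∀ l : List L, (∀ y ∈ l, y ∈ S) →
      ⁅x, (l.map (LieModule.toEnd ℂ L V)).prod v⁆ ∈ monomialSpan S v (l.length + d))
    {w : ℤ} {z : V} (hz : z ∈ monomialSpan S v w) : ⁅x, z⁆ ∈ monomialSpan S v (w + d) := by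
  induction hz using Submodule.span_induction with
  | mem z hz =>
    obtain ⟨l, hl, hlw, rfl⟩ := hz
    exact monomialSpan_mono subset_rfl (by omega) (h l hl)
  | zero => simp
  | add y z _ _ hy hz => rw [lie_add]; exact add_mem hy hz
  | smul c z _ hz => rw [lie_smul]; exact Submodule.smul_mem _ _ hz

lemma lie_mem_monomialSpan {x : L} (hx : x ∈ S) {w : ℤ} {z : V} (hz : z ∈ monomialSpan S v w) :
    ⁅x, z⁆ ∈ monomialSpan S v (w + 1) :=
  lie_mem_monomialSpan_of_forall (fun l hl ↦ prod_mem_monomialSpan (l := x :: l)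
    (by simpa [hx] using hl) (by simp)) hz

/-- An eigenvector in the span of a set of eigenvectors is in the span of those of them that have
the same eigenvalue. -/
lemma mem_span_of_apply_eq_smul (f : Module.End ℂ V) {A : Set V}
    (hA : ∀ m ∈ A, ∃ ν : ℂ, f m = ν • m) {μ : ℂ} {z : V} (hz : z ∈ Submodule.span ℂ A)
    (hμ : f z = μ • z) : z ∈ Submodule.span ℂ {m ∈ A | f m = μ • m} := by
  have hle : Submodule.span ℂ A ≤
      Submodule.span ℂ {m ∈ A | f m = μ • m} ⊔ ⨆ (ν) (_ : ν ≠ μ), f.eigenspace ν := by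
    refine Submodule.span_le.mpr fun m hm ↦ ?_
    obtain ⟨ν, hν⟩ := hA m hm
    by_cases h : ν = μ
    · subst h
      exact Submodule.mem_sup_left (Submodule.subset_span ⟨hm, hν⟩)
    · exact Submodule.mem_sup_right (Submodule.mem_iSup_of_mem ν
        (Submodule.mem_iSup_of_mem h (Module.End.mem_eigenspace_iff.mpr hν)))
  obtain ⟨a, ha, c, hc, rfl⟩ := Submodule.mem_sup.mp (hle hz)
  have hspan : Submodule.span ℂ {m ∈ A | f m = μ • m} ≤ f.eigenspace μ :=
    Submodule.span_le.mpr fun m hm ↦ Module.End.mem_eigenspace_iff.mpr hm.2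
  have hcμ : c ∈ f.eigenspace μ := by
    have := sub_mem (Module.End.mem_eigenspace_iff.mpr hμ) (hspan ha)
    simpa using this
  have := (Submodule.disjoint_def.mp (f.eigenspaces_iSupIndep μ)) c hcμ hc
  rwa [this, add_zero]

/-- A family of homogeneous elements for the eigenvalues of `h`, in degrees `-2, …, 2`, for which
the brackets of degree `2` with degree `-2` are multiples of `h`. The model is the grading given by
the coroot of a highest root. Only sets of homogeneous elements are recorded, not their spans. -/
structure IsContactGrading (g : ℤ → Set L) (h : L) : Prop where
  lie_mem : ∀ {i j : ℤ} {x y : L}, x ∈ g i → y ∈ g j → ⁅x, y⁆ ∈ g (i + j)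
  lie_h : ∀ {i : ℤ} {x : L}, x ∈ g i → ⁅h, x⁆ = (i : ℂ) • x
  eq_zero : ∀ {i : ℤ} {x : L}, x ∈ g i → 2 < |i| → x = 0
  lie_two : ∀ {x y : L}, x ∈ g 2 → y ∈ g (-2) → ∃ t : ℂ, ⁅x, y⁆ = t • h

namespace IsContactGrading

variable {g : ℤ → Set L} {h : L} (hg : IsContactGrading g h) {μ : ℂ} (hv : ⁅h, v⁆ = μ • v)
  (hpos : ∀ i > 0, ∀ x ∈ g i, ⁅x, v⁆ = 0)

include hg hv

/-- Monomials in elements of degree at most `0` are `h`-eigenvectors. The shift `d` of the eigenvalue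
is the total degree, which is zero only if all factors have degree `0`. -/
lemma lie_h_prod {l : List L} (hl : ∀ x ∈ l, x ∈ {x | ∃ i ≤ 0, x ∈ g i}) :
    ∃ d : ℤ, d ≤ 0 ∧ (d = 0 → ∀ x ∈ l, x ∈ g 0) ∧
      ⁅h, (l.map (LieModule.toEnd ℂ L V)).prod v⁆ =
        (μ + d) • (l.map (LieModule.toEnd ℂ L V)).prod v := by
  induction l with
  | nil => exact ⟨0, by simp [hv]⟩
  | cons x l ih =>
    obtain ⟨d, hd, hd0, hdl⟩ := ih fun y hy ↦ hl y (by simp [hy])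
    obtain ⟨i, hi, hx⟩ := hl x (by simp)
    refine ⟨i + d, by omega, fun h0 y hy ↦ ?_, ?_⟩
    · obtain rfl : i = 0 := by omega
      rcases List.mem_cons.mp hy with rfl | hy
      exacts [hx, hd0 (by omega) y hy]
    · simp only [List.map_cons, List.prod_cons, Module.End.mul_apply, LieModule.toEnd_apply_apply]
      rw [leibniz_lie, hg.lie_h hx, hdl, smul_lie, lie_smul, ← add_smul]
      push_cast
      congr 1
      ring

include hpos

omit hv in
lemma lie_one_prod {x : L} (hx : x ∈ g 1) {l : List L}
    (hl : ∀ y ∈ l, y ∈ {x | ∃ i ≤ 0, x ∈ g i}) :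
    ⁅x, (l.map (LieModule.toEnd ℂ L V)).prod v⁆ ∈
      monomialSpan {x | ∃ i ≤ 0, x ∈ g i} v (l.length + 0) := by
  induction l generalizing x with
  | nil => simp [hpos 1 one_pos x hx]
  | cons y l ih =>
    have hl' : ∀ y ∈ l, y ∈ {x | ∃ i ≤ 0, x ∈ g i} := fun z hz ↦ hl z (by simp [hz])
    obtain ⟨i, hi, hy⟩ := hl y (by simp)
    simp only [List.map_cons, List.prod_cons, Module.End.mul_apply, LieModule.toEnd_apply_apply,
      List.length_cons, Nat.cast_add, Nat.cast_one]
    rw [leibniz_lie]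
    refine add_mem ?_ ?_
    · rcases hi.eq_or_lt with rfl | hi
      · exact monomialSpan_mono subset_rfl (by omega) (ih (by simpa using hg.lie_mem hx hy) hl')
      · exact monomialSpan_mono subset_rfl (by omega) (lie_mem_monomialSpan
          (S := {x | ∃ i ≤ 0, x ∈ g i}) ⟨1 + i, by omega, hg.lie_mem hx hy⟩
          (prod_mem_monomialSpan hl' le_rfl))
    · exact monomialSpan_mono subset_rfl (by omega) (lie_mem_monomialSpan
        (S := {x | ∃ i ≤ 0, x ∈ g i}) ⟨i, hi, hy⟩ (ih hx hl'))

/-- An element of degree `2` lowers the length of monomials in elements of degree at most `0`: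
commuting it to the right, where it kills `v`, absorbs either two factors of degree `-1`, replaced
by one of degree `0`, or one factor of degree `-2`, replaced by a multiple of `h`. -/
lemma lie_two_prod {x : L} (hx : x ∈ g 2) {l : List L}
    (hl : ∀ y ∈ l, y ∈ {x | ∃ i ≤ 0, x ∈ g i}) :
    ⁅x, (l.map (LieModule.toEnd ℂ L V)).prod v⁆ ∈
      monomialSpan {x | ∃ i ≤ 0, x ∈ g i} v (l.length + (-1)) := by
  induction l generalizing x with
  | nil => simp [hpos 2 two_pos x hx]
  | cons y l ih =>
    have hl' : ∀ y ∈ l, y ∈ {x | ∃ i ≤ 0, x ∈ g i} := fun z hz ↦ hl z (by simp [hz])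
    obtain ⟨i, hi, hy⟩ := hl y (by simp)
    simp only [List.map_cons, List.prod_cons, Module.End.mul_apply, LieModule.toEnd_apply_apply,
      List.length_cons, Nat.cast_add, Nat.cast_one]
    rw [leibniz_lie]
    refine add_mem ?_ ?_
    · by_cases h3 : i < -2
      · have : y = 0 := hg.eq_zero hy (by rw [abs_of_nonpos hi]; omega)
        simp [this]
      have hcases : i = 0 ∨ i = -1 ∨ i = -2 := by omega
      rcases hcases with rfl | rfl | rfl
      · exact monomialSpan_mono subset_rfl (by omega) (ih (by simpa using hg.lie_mem hx hy) hl')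
      · exact monomialSpan_mono subset_rfl (by omega)
          (hg.lie_one_prod hpos (by simpa using hg.lie_mem hx hy) hl')
      · obtain ⟨t, ht⟩ := hg.lie_two hx hy
        obtain ⟨d, -, -, hd⟩ := hg.lie_h_prod hv hl'
        rw [ht, smul_lie, hd]
        exact Submodule.smul_mem _ _ (Submodule.smul_mem _ _
          (prod_mem_monomialSpan hl' (by omega)))
    · exact monomialSpan_mono subset_rfl (by omega) (lie_mem_monomialSpan
        (S := {x | ∃ i ≤ 0, x ∈ g i}) ⟨i, hi, hy⟩ (ih hx hl'))

/-- In a monomial applied to `v`, the factors of positive degree can be eliminated without raising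
the filtration level. -/
lemma monomialSpan_le (w : ℤ) :
    monomialSpan {x | ∃ i, x ∈ g i} v w ≤ monomialSpan {x | ∃ i ≤ 0, x ∈ g i} v w := by
  refine Submodule.span_le.mpr ?_
  rintro _ ⟨l, hl, hlw, rfl⟩
  induction l generalizing w with
  | nil => exact prod_mem_monomialSpan (by simp) hlw
  | cons x l ih =>
    obtain ⟨i, hx⟩ := hl x (by simp)
    have ih' := ih (w - 1) (fun z hz ↦ hl z (by simp [hz])) (by simp at hlw; omega)
    simp only [List.map_cons, List.prod_cons, Module.End.mul_apply, LieModule.toEnd_apply_apply,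
      SetLike.mem_coe] at ih' ⊢
    by_cases h0 : i ≤ 0
    · simpa using lie_mem_monomialSpan (S := {x | ∃ i ≤ 0, x ∈ g i}) ⟨i, h0, hx⟩ ih'
    by_cases h3 : 2 < i
    · simp [hg.eq_zero hx (h3.trans_le (le_abs_self i))]
    have hcases : i = 1 ∨ i = 2 := by omega
    rcases hcases with rfl | rfl
    · exact monomialSpan_mono subset_rfl (by omega)
        (lie_mem_monomialSpan_of_forall (fun l ↦ hg.lie_one_prod hpos hx) ih')
    · exact monomialSpan_mono subset_rfl (by omega)
        (lie_mem_monomialSpan_of_forall (fun l ↦ hg.lie_two_prod hv hpos hx) ih')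

/-- If `n` applications of an element of degree `2` bring a vector of filtration level `w` to the
`h`-weight of `v`, the result has level `w - n`, and for the subalgebra of degree `0` only. -/
lemma pow_toEnd_mem_monomialSpan {e : L} (he : e ∈ g 2) (n : ℕ) {w : ℤ} {z : V}
    (hz : z ∈ monomialSpan {x | ∃ i, x ∈ g i} v w)
    (hh : ⁅h, (LieModule.toEnd ℂ L V e ^ n) z⁆ = μ • (LieModule.toEnd ℂ L V e ^ n) z) :
    (LieModule.toEnd ℂ L V e ^ n) z ∈ monomialSpan (g 0) v (w - n) := by
  have key : (LieModule.toEnd ℂ L V e ^ n) z ∈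
      monomialSpan {x | ∃ i ≤ 0, x ∈ g i} v (w - n) := by
    clear hh
    induction n with
    | zero => simpa using hg.monomialSpan_le hv hpos w hz
    | succ n ih =>
      rw [pow_succ', Module.End.mul_apply, LieModule.toEnd_apply_apply]
      exact monomialSpan_mono subset_rfl (by push_cast; omega)
        (lie_mem_monomialSpan_of_forall (fun l ↦ hg.lie_two_prod hv hpos he) ih)
  generalize (LieModule.toEnd ℂ L V e ^ n) z = z' at key hh
  refine Submodule.span_le.mpr ?_
    (mem_span_of_apply_eq_smul (LieModule.toEnd ℂ L V h) ?_ key hh)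
  · rintro _ ⟨⟨l, hl, hlw, rfl⟩, hm⟩
    obtain ⟨d, -, hd0, hd⟩ := hg.lie_h_prod hv hl
    rw [LieModule.toEnd_apply_apply, hd, add_smul, add_eq_left, smul_eq_zero] at hm
    rcases hm with hm | hm
    · exact prod_mem_monomialSpan (hd0 (by exact_mod_cast hm)) hlw
    · rw [hm]; exact zero_mem _
  · rintro _ ⟨l, hl, hlw, rfl⟩
    obtain ⟨d, -, -, hd⟩ := hg.lie_h_prod hv hl
    exact ⟨_, hd⟩

end IsContactGrading

/-- On a highest weight vector of weight `n` for `sl₂`, applying `e ^ n` undoes `f ^ n` up to a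
nonzero factor. -/
lemma exists_pow_toEnd_pow_toEnd_eq_smul {h e f : L} (t : IsSl2Triple h e f) {m : V} {n : ℕ}
    (hh : ⁅h, m⁆ = (n : ℂ) • m) (he : ⁅e, m⁆ = 0) :
    ∃ c : ℂ, c ≠ 0 ∧
      (LieModule.toEnd ℂ L V e ^ n) ((LieModule.toEnd ℂ L V f ^ n) m) = c • m := by
  by_cases hm : m = 0
  · exact ⟨1, one_ne_zero, by simp [hm]⟩
  have p : t.HasPrimitiveVectorWith m (n : ℂ) := ⟨hm, hh, he⟩
  have key (k : ℕ) (hk : k ≤ n) : ∃ c : ℂ, c ≠ 0 ∧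
      (LieModule.toEnd ℂ L V e ^ k) ((LieModule.toEnd ℂ L V f ^ k) m) = c • m := by
    induction k with
    | zero => exact ⟨1, one_ne_zero, by simp⟩
    | succ k ih =>
      obtain ⟨c, hc, h⟩ := ih (by omega)
      refine ⟨((k + 1) * (n - k)) * c, ?_, ?_⟩
      · have h1 : (k : ℂ) + 1 ≠ 0 := by exact_mod_cast k.succ_ne_zero
        have h2 : (n : ℂ) - k ≠ 0 := by
          rw [sub_ne_zero]
          exact_mod_cast (show n ≠ k by omega)
        exact mul_ne_zero (mul_ne_zero h1 h2) hc
      · rw [pow_succ (LieModule.toEnd ℂ L V e), Module.End.mul_apply,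
          LieModule.toEnd_apply_apply, p.lie_e_pow_succ_toEnd_f, map_smul, h, smul_smul]
  exact key n le_rfl

end Grading

/-! ### Root vectors of the cascade and highest weight vectors -/

section RootSpaces

open LieAlgebra LieAlgebra.IsKilling

variable {L : Type*} [LieRing L] [LieAlgebra ℂ L] [FiniteDimensional ℂ L] [IsKilling ℂ L]
  {H : LieSubalgebra ℂ L} [H.IsCartanSubalgebra]

/-- The coefficient of a root `β` in Dadok's construction in terms of coroots. -/
lemma dadokCoeff_eq (w : (rootSystem H).weylGroup) (lam : Module.Dual ℂ H) (β : H.root) :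
    dadokCoeff w lam β =
      (lam ((rootSystem H).coroot β) - (w • lam) ((rootSystem H).coroot β)) / 2 := by
  have hform (φ ψ : Module.Dual ℂ H) : killingDual φ ψ = φ ((cartanEquivDual H).symm ψ) :=
    LinearMap.congr_fun ((cartanEquivDual H).apply_symm_apply φ) ((cartanEquivDual H).symm ψ)
  set ρ := (rootSystem H).root β
  set t := (cartanEquivDual H).symm ρ
  have hne : ρ t ≠ 0 := root_apply_cartanEquivDual_symm_ne_zero (H.isNonZero_coe_root β)
  have hco : (rootSystem H).coroot β = (2 : ℕ) • (ρ t)⁻¹ • t := rfl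
  change (killingDual lam ρ - killingDual (w • lam) ρ) / killingDual ρ ρ = _
  rw [hform, hform, hform]
  change (lam t - (w • lam) t) / ρ t = _
  rw [hco, map_nsmul, map_nsmul, map_smul, map_smul]
  simp only [nsmul_eq_mul, smul_eq_mul]
  push_cast
  field_simp

variable (H) in
/-- The union of the root spaces of weights in `W`; that of the weight zero is `H`. When the roots
in `W` form the subsystem reached in Dadok's construction, these are the homogeneous elements of the
reductive subalgebra with that root system. -/
def homogeneousIn (W : Submodule ℂ (Module.Dual ℂ H)) : Set L :=
  {x | ∃ χ ∈ W, x ∈ rootSpace H χ}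

variable (H) in
/-- The elements of `homogeneousIn H W` whose weight takes the value `i` on the coroot of `β`. -/
def gradedIn (W : Submodule ℂ (Module.Dual ℂ H)) (β : H.root) (i : ℤ) : Set L :=
  {x | ∃ χ ∈ W, χ ((rootSystem H).coroot β) = i ∧ x ∈ rootSpace H χ}

lemma eq_zero_or_exists_root {χ : Module.Dual ℂ H} {x : L} (hx : x ∈ rootSpace H χ) (hx0 : x ≠ 0) :
    χ = 0 ∨ ∃ α : H.root, (rootSystem H).root α = χ := by
  by_cases hχ : χ = 0
  · exact Or.inl hχ
  have hbot : LieModule.genWeightSpace L (χ : H → ℂ) ≠ ⊥ := fun h ↦ hx0 (by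
    have : x ∈ LieModule.genWeightSpace L (χ : H → ℂ) := hx
    rwa [h, LieSubmodule.mem_bot] at this)
  let α : LieModule.Weight ℂ H L := ⟨χ, hbot⟩
  have hα : α.IsNonZero := fun h ↦ hχ (by ext y; exact congrFun h y)
  exact Or.inr ⟨⟨α, by simpa using hα⟩, by ext y; rfl⟩

omit [FiniteDimensional ℂ L] [IsKilling ℂ L] in
lemma lie_mem_rootSpace {χ ψ : Module.Dual ℂ H} {x y : L} (hx : x ∈ rootSpace H χ)
    (hy : y ∈ rootSpace H ψ) : ⁅x, y⁆ ∈ rootSpace H (χ + ψ : Module.Dual ℂ H) :=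
  lie_mem_genWeightSpace_of_mem_genWeightSpace hx hy

variable {b : (rootSystem H).Base} {W : Submodule ℂ (Module.Dual ℂ H)} {β : H.root}

lemma homogeneousIn_eq_iUnion (W : Submodule ℂ (Module.Dual ℂ H)) (β : H.root) :
    homogeneousIn H W = {x | ∃ i, x ∈ gradedIn H W β i} := by
  ext x
  refine ⟨fun ⟨χ, hχ, hx⟩ ↦ ?_, fun ⟨i, χ, hχ, _, hx⟩ ↦ ⟨χ, hχ, hx⟩⟩
  by_cases hx0 : x = 0
  · exact ⟨0, 0, W.zero_mem, by simp, hx0 ▸ zero_mem _⟩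
  rcases eq_zero_or_exists_root hx hx0 with rfl | ⟨α, rfl⟩
  · exact ⟨0, 0, hχ, by simp, hx⟩
  · exact ⟨(rootSystem H).pairingIn ℤ α β, _, hχ,
      ((rootSystem H).algebraMap_pairingIn ℤ α β).symm, hx⟩

lemma gradedIn_zero :
    gradedIn H W β 0 = homogeneousIn H (W ⊓ LinearMap.ker ((rootSystem H).coroot' β)) := by
  ext x
  constructor
  · rintro ⟨χ, hχ, h, hx⟩
    exact ⟨χ, ⟨hχ, by simpa using h⟩, hx⟩
  · rintro ⟨χ, ⟨hχ, h⟩, hx⟩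
    exact ⟨χ, hχ, by simpa using h, hx⟩

/-- A nonzero homogeneous element of nonzero degree is a root vector. -/
lemma exists_root_of_mem_gradedIn {i : ℤ} (hi : i ≠ 0) {χ : Module.Dual ℂ H}
    (h : χ ((rootSystem H).coroot β) = i) {x : L} (hx : x ∈ rootSpace H χ) (hx0 : x ≠ 0) :
    ∃ α : H.root, (rootSystem H).root α = χ ∧ (rootSystem H).pairingIn ℤ α β = i := by
  rcases eq_zero_or_exists_root hx hx0 with rfl | ⟨α, rfl⟩
  · exact absurd (by simpa using h.symm) hi
  · refine ⟨α, rfl, ?_⟩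
    have := (rootSystem H).algebraMap_pairingIn ℤ α β
    rw [← (rootSystem H).root_coroot_eq_pairing, rootSystem_toLinearMap_apply, h] at this
    rw [eq_intCast] at this
    exact_mod_cast this

/-- The pairings with a highest root `β` have absolute value at most two, and `β` and `-β` are the
only roots that attain it; so the spaces of degree `2` and `-2` are the root spaces of `β` and
`-β`. -/
lemma isContactGrading_gradedIn
    (hβ : IsHighestRoot b (component (rootSystem H) (rootsIn (rootSystem H) W) β) β)
    (hβW : (rootSystem H).root β ∈ W) :
    IsContactGrading (gradedIn H W β) ((rootSystem H).coroot β : L) := by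
  have hneg {α : H.root} (hα : (rootSystem H).root α ∈ W)
      (h : (rootSystem H).pairingIn ℤ α β ≤ -2) :
      (rootSystem H).root α = -(rootSystem H).root β := by
    have := hβ.eq_of_two_le_pairing hβW (α := (rootSystem H).reflectionPerm α α)
      (by rw [root_reflectionPerm_self]; exact W.neg_mem hα)
      (by rw [RootPairing.pairingIn_reflectionPerm_self_left]; omega)
    rw [← this, root_reflectionPerm_self, neg_neg]
  refine ⟨?_, ?_, ?_, ?_⟩
  · rintro i j x y ⟨χ, hχ, hi, hx⟩ ⟨ψ, hψ, hj, hy⟩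
    exact ⟨χ + ψ, W.add_mem hχ hψ, by rw [LinearMap.add_apply, hi, hj]; push_cast; rfl,
      lie_mem_rootSpace hx hy⟩
  · rintro i x ⟨χ, hχ, hi, hx⟩
    rw [← hi]
    exact lie_eq_smul_of_mem_rootSpace hx _
  · rintro i x ⟨χ, hχ, hi, hx⟩ hi2
    by_contra hx0
    obtain ⟨α, rfl, hα⟩ := exists_root_of_mem_gradedIn
      (fun h ↦ by rw [h] at hi2; simp at hi2) hi hx hx0
    rcases lt_abs.mp hi2 with h | h
    · obtain rfl := hβ.eq_of_two_le_pairing hβW hχ (by omega)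
      rw [RootPairing.pairingIn_same] at hα
      omega
    · have hroot := hneg hχ (by omega)
      rw [hroot, LinearMap.neg_apply] at hi
      have h2 : (rootSystem H).root β ((rootSystem H).coroot β) = 2 :=
        (rootSystem H).root_coroot_two β
      rw [h2] at hi
      have : (-2 : ℤ) = i := by exact_mod_cast hi
      omega
  · rintro x y ⟨χ, hχ, hi, hx⟩ ⟨ψ, hψ, hj, hy⟩
    by_cases hx0 : x = 0
    · exact ⟨0, by simp [hx0]⟩
    by_cases hy0 : y = 0
    · exact ⟨0, by simp [hy0]⟩
    obtain ⟨α, rfl, hα⟩ := exists_root_of_mem_gradedIn (by norm_num) hi hx hx0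
    obtain ⟨γ, rfl, hγ⟩ := exists_root_of_mem_gradedIn (by norm_num) hj hy hy0
    obtain rfl := hβ.eq_of_two_le_pairing hβW hχ hα.ge
    rw [hneg hψ hγ.le] at hy
    have hne := root_apply_cartanEquivDual_symm_ne_zero (H.isNonZero_coe_root α)
    refine ⟨killingForm ℂ L x y * (α.1 ((cartanEquivDual H).symm α.1)) / 2, ?_⟩
    rw [lie_eq_killingForm_smul_of_mem_rootSpace_of_mem_rootSpace_neg (α := α.1) hx hy,
      rootSystem_coroot_apply, coroot]
    have : (killingForm ℂ L x y) • (cartanEquivDual H).symm α.1.toLinear =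
        (killingForm ℂ L x y * (α.1 ((cartanEquivDual H).symm α.1)) / 2) •
          (2 • (α.1 ((cartanEquivDual H).symm α.1))⁻¹ • (cartanEquivDual H).symm α.1.toLinear) := by
      rw [← Nat.cast_smul_eq_nsmul ℂ, smul_smul, smul_smul]
      congr 1
      push_cast
      field_simp
    exact congrArg (Subtype.val) this

/-- Every nonzero root vector for `-α` is the lowering element of an `sl₂`-triple with the coroot of
`α`. -/
lemma exists_isSl2Triple {α : H.root} {x : L} (hx0 : x ≠ 0)
    (hx : x ∈ rootSpace H (-((rootSystem H).root α))) :
    ∃ e ∈ rootSpace H ((rootSystem H).root α), IsSl2Triple ((rootSystem H).coroot α : L) e x := by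
  have hα := H.isNonZero_coe_root α
  obtain ⟨h, e, f, t, he, hf⟩ := exists_isSl2Triple_of_weight_isNonZero hα
  have hh := t.h_eq_coroot hα he hf
  have hrank := finrank_rootSpace_eq_one (-α.1) (by simpa using hα)
  obtain ⟨c, hc⟩ := (finrank_eq_one_iff_of_nonzero' (⟨f, hf⟩ : rootSpace H (-α.1))
    (fun h0 ↦ t.f_ne_zero (congrArg Subtype.val h0))).mp hrank ⟨x, hx⟩
  have hc : c • f = x := congrArg Subtype.val hc
  have hc0 : c ≠ 0 := by rintro rfl; exact hx0 (by rw [← hc, zero_smul])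
  refine ⟨c⁻¹ • e, Submodule.smul_mem _ _ he, ?_⟩
  rw [rootSystem_coroot_apply, ← hh, ← hc]
  refine ⟨t.h_ne_zero, ?_, ?_, ?_⟩
  · rw [smul_lie, lie_smul, smul_smul, inv_mul_cancel₀ hc0, one_smul, t.lie_e_f]
  · rw [lie_smul, t.lie_h_e_nsmul, smul_comm]
  · rw [lie_smul, t.lie_h_f_nsmul, smul_neg, smul_comm]

variable {V : Type*} [AddCommGroup V] [Module ℂ V] [LieRingModule L V] [LieModule ℂ L V]

omit [FiniteDimensional ℂ L] [IsKilling ℂ L] in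
lemma lie_prod_pow_toEnd {s : ℕ} {X : Fin s → L} {y : L} (hy : ∀ i, ⁅y, X i⁆ = 0) (n : Fin s → ℕ)
    (v : V) :
    ⁅y, (List.ofFn fun i => LieModule.toEnd ℂ L V (X i) ^ n i).prod v⁆ =
      (List.ofFn fun i => LieModule.toEnd ℂ L V (X i) ^ n i).prod ⁅y, v⁆ := by
  have : Commute (LieModule.toEnd ℂ L V y)
      (List.ofFn fun i => LieModule.toEnd ℂ L V (X i) ^ n i).prod := by
    refine Commute.list_prod_right _ _ fun z hz ↦ ?_
    obtain ⟨i, rfl⟩ := (List.mem_ofFn' _ _).mp hz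
    refine Commute.pow_right ?_ _
    ext m
    simp only [Module.End.mul_apply, LieModule.toEnd_apply_apply]
    rw [leibniz_lie, hy, zero_lie, zero_add]
  exact LinearMap.congr_fun this v

variable {lam : Module.Dual ℂ H} {v : V}

lemma IsHighestWeightVector.lie_eq_zero (hv : IsHighestWeightVector b lam v)
    (hβ : IsHighestRoot b (component (rootSystem H) (rootsIn (rootSystem H) W) β) β)
    (hβW : (rootSystem H).root β ∈ W) : ∀ i > 0, ∀ x ∈ gradedIn H W β i, ⁅x, v⁆ = 0 := by
  rintro i hi x ⟨χ, hχ, h, hx⟩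
  by_cases hx0 : x = 0
  · simp [hx0]
  obtain ⟨α, rfl, hα⟩ := exists_root_of_mem_gradedIn hi.ne' h hx hx0
  exact hv.pos α (hβ.isPos_of_pairing_pos hβW hχ (by omega)) x hx

/-- The lower bound for the filtration level. The root `β 0` is split off: applying `n 0` times the
root vector for `β 0` undoes the `n 0` applications of `X 0`, lowers the level by `n 0` and leaves
a vector of the subalgebra attached to the roots orthogonal to `β 0`. -/
theorem sum_le_of_prod_mem_monomialSpan (hv : IsHighestWeightVector b lam v) {s : ℕ}
    {β : Fin s → H.root} {W : Submodule ℂ (Module.Dual ℂ H)}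
    (hβ : IsDadokSequence b (rootsIn (rootSystem H) W) (List.ofFn β))
    {X : Fin s → L} (hX0 : ∀ i, X i ≠ 0)
    (hX : ∀ i, X i ∈ rootSpace H (-((rootSystem H).root (β i))))
    {n : Fin s → ℕ} (hn : ∀ i, lam ((rootSystem H).coroot (β i)) = n i) {w : ℤ}
    (hw : (List.ofFn fun i => LieModule.toEnd ℂ L V (X i) ^ n i).prod v ∈
      monomialSpan (homogeneousIn H W) v w) :
    ((∑ i, n i : ℕ) : ℤ) ≤ w := by
  induction s generalizing W w with
  | zero =>
    by_contra! hlt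
    rw [monomialSpan_eq_bot (by simpa using hlt)] at hw
    exact hv.ne_zero (by simpa using hw)
  | succ s ih =>
    rw [List.ofFn_succ] at hβ
    rw [List.ofFn_succ, List.prod_cons, Module.End.mul_apply] at hw
    obtain ⟨hβW, hhigh, htail⟩ := hβ.cons_rootsIn
    set z := (List.ofFn fun i : Fin s => LieModule.toEnd ℂ L V (X i.succ) ^ n i.succ).prod v
      with hz
    obtain ⟨e, he, t⟩ := exists_isSl2Triple (hX0 0) (hX 0)
    have hmem (i : Fin s) : (rootSystem H).root (β i.succ) ∈ W ∧
        (rootSystem H).pairing (β i.succ) (β 0) = 0 := by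
      have := htail.subset (β i.succ) (by simp)
      exact ⟨this.1, by simpa using this.2⟩
    have hv0 : ⁅((rootSystem H).coroot (β 0) : L), v⁆ = (n 0 : ℂ) • v := by
      rw [hv.weight, hn]
    have hhz : ⁅((rootSystem H).coroot (β 0) : L), z⁆ = (n 0 : ℂ) • z := by
      rw [hz, lie_prod_pow_toEnd (X := fun i : Fin s ↦ X i.succ), hv0, map_smul]
      intro i
      have := lie_eq_smul_of_mem_rootSpace (hX i.succ) ((rootSystem H).coroot (β 0))
      have h0 : (rootSystem H).root (β i.succ) ((rootSystem H).coroot (β 0)) = 0 := (hmem i).2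
      refine this.trans ?_
      rw [Pi.neg_apply, h0, neg_zero, zero_smul]
    have he2 : e ∈ gradedIn H W (β 0) 2 :=
      ⟨_, hβW, by simpa using (rootSystem H).root_coroot_two (β 0), he⟩
    have hez : ⁅e, z⁆ = 0 := by
      rw [hz, lie_prod_pow_toEnd (X := fun i : Fin s ↦ X i.succ),
        hv.lie_eq_zero hhigh hβW 2 two_pos e he2, map_zero]
      -- The roots `β 0` and `β i` are strongly orthogonal: a root `β 0 - β i` would have pairing
      -- two with `β 0`, hence equal it.
      intro i
      by_contra h0
      have hlie : ⁅e, X i.succ⁆ ∈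
          rootSpace H ((rootSystem H).root (β 0) + -(rootSystem H).root (β i.succ) :
            Module.Dual ℂ H) := lie_mem_rootSpace he (hX i.succ)
      have h1 : (rootSystem H).root (β 0) ((rootSystem H).coroot (β 0)) = 2 :=
        (rootSystem H).root_coroot_two (β 0)
      have h2 : (rootSystem H).root (β i.succ) ((rootSystem H).coroot (β 0)) = 0 := (hmem i).2
      obtain ⟨α, hα, hα2⟩ := exists_root_of_mem_gradedIn (β := β 0) (i := 2) (by norm_num)
        (by rw [LinearMap.add_apply, LinearMap.neg_apply, h1, h2]; simp) hlie h0
      have := hhigh.eq_of_two_le_pairing hβW (α := α)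
        (by rw [hα]; exact W.add_mem hβW (W.neg_mem (hmem i).1)) hα2.ge
      rw [this, left_eq_add, neg_eq_zero] at hα
      exact (rootSystem H).ne_zero _ hα
    obtain ⟨c, hc, hcz⟩ := exists_pow_toEnd_pow_toEnd_eq_smul t hhz hez
    have hg := isContactGrading_gradedIn hhigh hβW
    rw [homogeneousIn_eq_iUnion W (β 0)] at hw
    have key := hg.pow_toEnd_mem_monomialSpan hv0 (hv.lie_eq_zero hhigh hβW) he2 (n 0) hw
      (by rw [hcz, lie_smul, hhz, smul_comm])
    rw [hcz, gradedIn_zero, Submodule.smul_mem_iff _ hc] at key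
    have := ih htail (fun i ↦ hX0 i.succ) (fun i ↦ hX i.succ) (fun i ↦ hn i.succ) key
    rw [Fin.sum_univ_succ]
    push_cast at this ⊢
    omega

omit [IsKilling ℂ L] in
lemma lie_mem_monomialSpan_top (x : L) {w : ℤ} {z : V}
    (hz : z ∈ monomialSpan (homogeneousIn H ⊤) v w) :
    ⁅x, z⁆ ∈ monomialSpan (homogeneousIn H ⊤) v (w + 1) := by
  have hx : x ∈ (⨆ χ : LieModule.Weight ℂ H L, LieModule.genWeightSpace L χ).toSubmodule := by
    rw [LieModule.iSup_genWeightSpace_eq_top']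
    trivial
  rw [LieSubmodule.iSup_toSubmodule] at hx
  induction hx using Submodule.iSup_induction' with
  | mem χ x hx => exact lie_mem_monomialSpan (S := homogeneousIn H ⊤) ⟨χ.toLinear, trivial, hx⟩ hz
  | zero => simp
  | add x y _ _ hx hy => rw [add_lie]; exact add_mem hx hy

omit [IsKilling ℂ L] in
lemma filtrationOrbit_subset (k : ℕ) :
    filtrationOrbit L k v ⊆ monomialSpan (homogeneousIn H ⊤) v k := by
  rintro _ ⟨u, hu, rfl⟩
  induction hu using Submodule.span_induction with
  | mem u hu =>
    obtain ⟨l, hl, rfl⟩ := hu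
    induction l generalizing k with
    | nil =>
      rw [List.map_nil, List.prod_nil, map_one]
      exact prod_mem_monomialSpan (l := []) (by simp) (by simp)
    | cons x l ih =>
      obtain ⟨k, rfl⟩ : ∃ k', k = k' + 1 := ⟨k - 1, by simp at hl; omega⟩
      rw [List.map_cons, List.prod_cons, map_mul, UniversalEnvelopingAlgebra.lift_ι_apply,
        Module.End.mul_apply, LieModule.toEnd_apply_apply]
      push_cast
      exact lie_mem_monomialSpan_top x (ih k (by simpa using hl))
  | zero => simp
  | add x y _ _ hx hy => rw [map_add, LinearMap.add_apply]; exact add_mem hx hy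
  | smul c x _ hx => rw [map_smul, LinearMap.smul_apply]; exact Submodule.smul_mem _ _ hx

omit [FiniteDimensional ℂ L] [IsKilling ℂ L] in
lemma prod_pow_toEnd_mem_filtrationOrbit {s : ℕ} (X : Fin s → L) (n : Fin s → ℕ) (v : V) :
    (List.ofFn fun i => LieModule.toEnd ℂ L V (X i) ^ n i).prod v ∈
      filtrationOrbit L (∑ i, n i) v := by
  refine ⟨((List.ofFn fun i ↦ List.replicate (n i) (X i)).flatten.map
    (UniversalEnvelopingAlgebra.ι ℂ)).prod, Submodule.subset_span ⟨_, ?_, rfl⟩, ?_⟩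
  · simp [List.length_flatten, List.sum_ofFn, Function.comp_def]
  · congr 1
    rw [map_list_prod, List.map_map, List.map_flatten, List.prod_flatten, List.map_ofFn,
      List.map_ofFn]
    congr 2
    funext i
    simp [Function.comp_def]

lemma IsHighestWeightVector.exists_nat [FiniteDimensional ℂ V] (hv : IsHighestWeightVector b lam v)
    {α : H.root} (hα : b.IsPos α) : ∃ n : ℕ, lam ((rootSystem H).coroot α) = n := by
  obtain ⟨h, e, f, t, he, hf⟩ := exists_isSl2Triple_of_weight_isNonZero (H.isNonZero_coe_root α)
  have hh := t.h_eq_coroot (H.isNonZero_coe_root α) he hf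
  have p : t.HasPrimitiveVectorWith v (lam ((rootSystem H).coroot α)) :=
    ⟨hv.ne_zero, by rw [hh]; exact hv.weight _, hv.pos α hα e he⟩
  exact p.exists_nat

end RootSpaces

end Dadok


theorem mainTheorem5
    {L : Type*} [LieRing L] [LieAlgebra ℂ L] [FiniteDimensional ℂ L] [LieAlgebra.IsSemisimple ℂ L]
    (H : LieSubalgebra ℂ L) [H.IsCartanSubalgebra]
    (b : (LieAlgebra.IsKilling.rootSystem H).Base)
    (w₀ : (LieAlgebra.IsKilling.rootSystem H).weylGroup) (hw₀ : Dadok.IsLongest b w₀)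
    {s : ℕ} (β : Fin s → H.root) (hβ : Dadok.IsDadokSequence b Set.univ (List.ofFn β))
    (X : Fin s → L) (hX0 : ∀ i, X i ≠ 0)
    (hX : ∀ i, X i ∈ LieAlgebra.rootSpace H (-((LieAlgebra.IsKilling.rootSystem H).root (β i))))
    {V : Type*} [AddCommGroup V] [Module ℂ V] [FiniteDimensional ℂ V]
    [LieRingModule L V] [LieModule ℂ L V] [LieModule.IsIrreducible ℂ L V]
    (lam : Module.Dual ℂ H) (v : V) (hv : Dadok.IsHighestWeightVector b lam v) :
    ∃ (n : Fin s → ℕ) (k : ℕ),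
      (∀ i, (n i : ℂ) = Dadok.dadokCoeff w₀ lam (β i)) ∧
      (k : ℂ) = Dadok.dadokInvariant w₀ β lam ∧
      (List.ofFn fun i => LieModule.toEnd ℂ L V (X i) ^ n i).prod v ∈
        Dadok.filtrationOrbit L k v ∧
      ∀ l < k, (List.ofFn fun i => LieModule.toEnd ℂ L V (X i) ^ n i).prod v ∉
        Dadok.filtrationOrbit L l v := by
  have hβ' : Dadok.IsDadokSequence b
      (Dadok.rootsIn (LieAlgebra.IsKilling.rootSystem H) ⊤) (List.ofFn β) := by
    convert hβ
    ext
    simp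
  choose n hn using fun i ↦ hv.exists_nat (hβ'.isPos (β i) (by simp))
  have hcoeff (i : Fin s) : (n i : ℂ) = Dadok.dadokCoeff w₀ lam (β i) := by
    have hw : w₀ • lam = Dadok.reflectionProd (LieAlgebra.IsKilling.rootSystem H)
        (List.ofFn β) lam :=
      hw₀.smul_eq_reflectionProd (fun i k hi hk ↦ hβ'.not_isPos_reflectionProd trivial hi hk) lam
    have h := hβ'.toLinearMap_reflectionProd_coroot lam (i := β i) (by simp)
    rw [← hw, LieAlgebra.IsKilling.rootSystem_toLinearMap_apply,
      LieAlgebra.IsKilling.rootSystem_toLinearMap_apply] at h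
    rw [Dadok.dadokCoeff_eq, h, hn]
    ring
  refine ⟨n, ∑ i, n i, hcoeff, ?_, Dadok.prod_pow_toEnd_mem_filtrationOrbit X n v,
    fun l hl hmem ↦ ?_⟩
  · rw [Dadok.dadokInvariant, Nat.cast_sum]
    exact Finset.sum_congr rfl fun i _ ↦ hcoeff i
  · have := Dadok.sum_le_of_prod_mem_monomialSpan hv hβ' hX0 hX hn
      (Dadok.filtrationOrbit_subset l hmem)
    omega
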